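/- Let $t=\tanh\frac12$. For real $\nu$ and $-1<x<1$ let $P_\nu(x)={}_2F_1\big(-\nu,1+\nu;1;\tfrac{1-x}{2}\big)$ be the Legendre function of the first kind and, for $\nu\notin\{-1,-2,\dots\}$, let $$Q_\nu(x)=-\tfrac{\sqrt\pi}{2}\sin\tfrac{\pi\nu}{2}\,\frac{\Gamma(\frac{\nu+1}{2})}{\Gamma(\frac\nu2+1)}\,{}_2F_1\big(-\tfrac\nu2,\tfrac{\nu+1}2;\tfrac12;x^2\big)+\sqrt\pi\cos\tfrac{\pi\nu}{2}\,\frac{\Gamma(\frac\nu2+1)}{\Gamma(\frac{\nu+1}2)}\,x\,{}_2F_1\big(\tfrac{1-\nu}2,\tfrac\nu2+1;\tfrac32;x^2\big)$$ be the Legendre function of the second kind on the cut $(-1,1)$, in its standard normalisation (so $Q_0(x)=\operatorname{artanh}x$). For real $l$ let $V_l(x)=-l(l+1)/\cosh^2x$ on $[-\frac12,\frac12]$. Let the ratio of the Dirichlet functional determinants of $-\frac{d^2}{dx^2}+V_l$ and $-\frac{d^2}{dx^2}$ on this interval be defined by the Gel'fand–Yaglom procedure, that is, as $y(\frac12)/y_0(\frac12)$,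 where $y$ and $y_0$ solve $-y''+V_ly=0$ and $-y_0''=0$ with $y(-\frac12)=y_0(-\frac12)=0$, $y'(-\frac12)=y_0'(-\frac12)=1$. (i) For every real $l\notin\{-1,-2,\dots\}$ this ratio equals $$\overline{\det}_C(l):=P_l(-t)\,Q_l(t)-P_l(t)\,Q_l(-t).$$ (ii) For every real non-integer $l$, $$\overline{\det}_C(l)=\frac{\pi}{2\sin\pi l}\big(P_l(t)^2-P_l(-t)^2\big).$$ (iii) For every integer $l\ge0$, $$\overline{\det}_C(l)=(-1)^l\,P_l(t)\Big(P_l(t)-2\sum_{m=1}^{l}\frac1m\,P_{m-1}(t)\,P_{l-m}(t)\Big).$$ -/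

import Mathlib

noncomputable section

namespace RosenMorse

/-- The Legendre function of the first kind `P_ν` on `(-1, 1)`, of real degree `ν`:
`P_ν(x) = ₂F₁(-ν, 1 + ν; 1; (1 - x) / 2)`. -/
def legendreP (ν x : ℝ) : ℝ := ₂F₁ (-ν) (1 + ν) (1 : ℝ) ((1 - x) / 2)

/-- The Legendre function of the second kind `Q_ν` on the cut `(-1, 1)`, of real degree
`ν ≠ -1, -2, -3, …`, in its hypergeometric form with even and odd parts:
`Q_ν(x) = -(√π / 2) sin(πν/2) Γ((ν+1)/2) / Γ(ν/2+1) ₂F₁(-ν/2, (ν+1)/2; 1/2; x²)`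
`       + √π cos(πν/2) Γ(ν/2+1) / Γ((ν+1)/2) x ₂F₁((1-ν)/2, ν/2+1; 3/2; x²)`.
For instance `Q_0(x) = artanh x` and `Q_1(x) = x artanh x - 1`. -/
def legendreQ (ν x : ℝ) : ℝ :=
  -(√Real.pi / 2) * Real.sin (Real.pi * ν / 2)
      * (Real.Gamma ((ν + 1) / 2) / Real.Gamma (ν / 2 + 1))
      * ₂F₁ (-ν / 2) ((ν + 1) / 2) (1 / 2 : ℝ) (x ^ 2)
    + √Real.pi * Real.cos (Real.pi * ν / 2)
      * (Real.Gamma (ν / 2 + 1) / Real.Gamma ((ν + 1) / 2))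
      * x * ₂F₁ ((1 - ν) / 2) (ν / 2 + 1) (3 / 2 : ℝ) (x ^ 2)

/-- The Rosen–Morse potential of strength `l`. -/
def potential (l x : ℝ) : ℝ := -(l * (l + 1)) / Real.cosh x ^ 2

/-- `y` is the Gel'fand–Yaglom function of the operator `-d²/dx² + V` on `[a, b]`: the solution of
`-y'' + V y = 0` on `[a, b]` with `y(a) = 0` and `y'(a) = 1`. -/
def IsGelfandYaglom (V : ℝ → ℝ) (a b : ℝ) (y : ℝ → ℝ) : Prop :=
  ∃ y' : ℝ → ℝ,
    (∀ x ∈ Set.Icc a b, HasDerivWithinAt y (y' x) (Set.Icc a b) x) ∧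
    (∀ x ∈ Set.Icc a b, HasDerivWithinAt y' (V x * y x) (Set.Icc a b) x) ∧
    y a = 0 ∧ y' a = 1

/-- `r` is the ratio `det(-d²/dx² + V) / det(-d²/dx²)` of the Dirichlet functional determinants on
`[a, b]` with and without the potential `V`, in the sense of Gel'fand and Yaglom: the quotient of
the values at `b` of the two Gel'fand–Yaglom functions. For continuous `V` these are unique
on `[a, b]`, so that `r` is determined by `V`, `a`, `b`. -/
def IsDetRatio (V : ℝ → ℝ) (a b r : ℝ) : Prop :=
  ∃ y y₀ : ℝ → ℝ, IsGelfandYaglom V a b y ∧ IsGelfandYaglom (fun _ => 0) a b y₀ ∧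
    y₀ b ≠ 0 ∧ r = y b / y₀ b

/-- `P_l(-t) Q_l(t) - P_l(t) Q_l(-t)`. -/
def contDet (l t : ℝ) : ℝ :=
  legendreP l (-t) * legendreQ l t - legendreP l t * legendreQ l (-t)

end RosenMorse

end

noncomputable section

namespace RosenMorse

open Filter Topology Finset

/-! ### Power series with polynomially bounded coefficients -/

/-! The substitution `x ↦ tanh x` turns the Schrödinger equation into the Legendre equation of
degree `l`. Written as a system for `f` and its flux `g = (1 - x²) f'`, the flux becomes the
ordinary derivative and `f q - p g` is a constant Wronskian. Let `E`, `O` be the even and odd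
solutions with unit data at `0`.

(i) The Gel'fand–Yaglom function is `O(t) E(tanh x) + E(t) O(tanh x)`, with end value `2 E(t) O(t)`;
the free one has end value `1`. Since `P` and `Q` arise from `E`, `O` by a matrix of determinant `1`
(`wronskian_legendreP_legendreQ`), the combination of `P` and `Q` is also `2 E(t) O(t)`
(`contDet_eq`).

(ii) By parity `P(t)² - P(-t)² = 4 P(0) P'(0) E(t) O(t)`, and `P(0) P'(0) = sin(πl) / π`. The two
values at `0` come from letting `x → 1` in the Wronskians of `P` with `O` and `E`, using Abel's
theorem and Euler's limit for `Γ`.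

(iii) For integer degree, `P` and `Q` obey the same three-term recurrence. A formal generating
function shows that Christoffel's sum obeys it too, so `Q_n = artanh · P_n - christoffelSum` from
two initial checks. Parity and `artanh t = 1/2` finish. -/

/-- The sum of the power series with coefficients `u`. -/
def powerSum (u : ℕ → ℝ) (z : ℝ) : ℝ := ∑' n, u n * z ^ n

/-- The coefficients of the derivative of a power series. -/
def derivCoeff (u : ℕ → ℝ) (n : ℕ) : ℝ := (n + 1) * u (n + 1)

/-- The sequence `u` grows at most polynomially. -/
def PolyBounded (u : ℕ → ℝ) : Prop := ∃ (C : ℝ) (k : ℕ), 0 ≤ C ∧ ∀ n, |u n| ≤ C * ((n : ℝ) + 1) ^ k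

lemma summable_succ_pow_mul_geometric (k : ℕ) {r : ℝ} (hr0 : 0 < r) (hr1 : r < 1) :
    Summable fun n : ℕ => ((n : ℝ) + 1) ^ k * r ^ n := by
  have h := summable_pow_mul_geometric_of_norm_lt_one (R := ℝ) k (r := r)
    (by rwa [Real.norm_of_nonneg hr0.le])
  have h1 := ((summable_nat_add_iff 1).2 h).mul_right r⁻¹
  refine h1.congr fun n => ?_
  push_cast
  field_simp
  ring

lemma PolyBounded.summable {u : ℕ → ℝ} (hu : PolyBounded u) {z : ℝ} (hz : |z| < 1) :
    Summable fun n => u n * z ^ n := by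
  obtain ⟨C, k, hC, h⟩ := hu
  obtain ⟨r, hzr, hr1⟩ := exists_between hz
  have hr0 : 0 < r := (abs_nonneg z).trans_lt hzr
  refine Summable.of_norm_bounded ((summable_succ_pow_mul_geometric k hr0 hr1).mul_left C) fun n => ?_
  rw [Real.norm_eq_abs, abs_mul, abs_pow, ← mul_assoc]
  exact mul_le_mul (h n) (pow_le_pow_left₀ (abs_nonneg _) hzr.le n) (by positivity) (by positivity)

lemma PolyBounded.hasSum {u : ℕ → ℝ} (hu : PolyBounded u) {z : ℝ} (hz : |z| < 1) :
    HasSum (fun n => u n * z ^ n) (powerSum u z) := (hu.summable hz).hasSum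

lemma PolyBounded.derivCoeff {u : ℕ → ℝ} (hu : PolyBounded u) : PolyBounded (derivCoeff u) := by
  obtain ⟨C, k, hC, h⟩ := hu
  refine ⟨C * 2 ^ k, k + 1, by positivity, fun n => ?_⟩
  have hn : (0 : ℝ) ≤ n := n.cast_nonneg
  rw [RosenMorse.derivCoeff, abs_mul, abs_of_nonneg (by positivity : (0 : ℝ) ≤ n + 1)]
  have h1 : |u (n + 1)| ≤ C * (2 * ((n : ℝ) + 1)) ^ k := by
    refine (h (n + 1)).trans ?_
    gcongr
    push_cast
    linarith
  calc ((n : ℝ) + 1) * |u (n + 1)| ≤ (n + 1) * (C * (2 * ((n : ℝ) + 1)) ^ k) := by gcongr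
    _ = _ := by rw [mul_pow]; ring

lemma PolyBounded.of_tendsto {u : ℕ → ℝ} {L : ℝ} (h : Tendsto u atTop (𝓝 L)) : PolyBounded u := by
  obtain ⟨M, hM⟩ := h.abs.bddAbove_range
  have hM' : ∀ n, |u n| ≤ M := fun n => hM ⟨n, rfl⟩
  exact ⟨M, 0, (abs_nonneg _).trans (hM' 0), fun n => by simpa using hM' n⟩

lemma hasDerivAt_powerSum {u : ℕ → ℝ} (hu : PolyBounded u) {z : ℝ} (hz : |z| < 1) :
    HasDerivAt (powerSum u) (powerSum (derivCoeff u) z) z := by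
  obtain ⟨r, hzr, hr1⟩ := exists_between hz
  have hr0 : 0 < r := (abs_nonneg z).trans_lt hzr
  have hsd : Summable fun n : ℕ => |u n| * (n * r ^ (n - 1)) := by
    rw [← summable_nat_add_iff 1]
    refine ((hu.derivCoeff.summable (by rwa [abs_of_pos hr0] : |r| < 1)).abs).congr fun n => ?_
    rw [derivCoeff, abs_mul, abs_mul, abs_of_pos (pow_pos hr0 n),
      abs_of_nonneg (by positivity : (0 : ℝ) ≤ n + 1)]
    push_cast
    ring
  have key := hasDerivAt_tsum_of_isPreconnected (𝕜 := ℝ) (g := fun n y => u n * y ^ n)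
    (g' := fun n y => u n * (n * y ^ (n - 1))) (t := Metric.ball 0 r) (y₀ := 0) (y := z) hsd
    Metric.isOpen_ball (convex_ball 0 r).isPreconnected
    (fun n y _ => (hasDerivAt_pow n y).const_mul (u n))
    (fun n y hy => by
      have hy' : |y| ≤ r := by simpa using (Metric.mem_ball.1 hy).le
      rw [Real.norm_eq_abs, abs_mul, abs_mul, abs_pow, Nat.abs_cast]
      gcongr)
    (Metric.mem_ball_self hr0) (hu.summable (by simp)) (by simpa using hzr)
  have hs : Summable fun n => u n * ((n : ℝ) * z ^ (n - 1)) := by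
    refine Summable.of_norm_bounded hsd fun n => ?_
    rw [Real.norm_eq_abs, abs_mul, abs_mul, abs_pow, Nat.abs_cast]
    gcongr
  have heq : ∑' n, u n * ((n : ℝ) * z ^ (n - 1)) = powerSum (derivCoeff u) z := by
    rw [hs.tsum_eq_zero_add, powerSum]
    simp only [derivCoeff, Nat.cast_zero, zero_mul, mul_zero, zero_add, Nat.add_sub_cancel]
    refine tsum_congr fun n => ?_
    push_cast
    ring
  rw [← heq]
  exact key

lemma hasSum_mul_shift {u v : ℕ → ℝ} {z S : ℝ} (h : HasSum (fun n => u n * z ^ n) S)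
    (h0 : v 0 = 0) (hv : ∀ n, v (n + 1) = u n) : HasSum (fun n => v n * z ^ n) (z * S) := by
  rw [← hasSum_nat_add_iff' 1]
  simp only [range_one, sum_singleton, h0, zero_mul, sub_zero, hv]
  have h' := h.mul_left z
  rw [show (fun n => z * (u n * z ^ n)) = fun n => u n * z ^ (n + 1) from
    funext fun n => by ring] at h'
  exact h'

/-- Abel's theorem for Cesàro-type limits: if `u n → L` then `(1 - z) ∑ u n z ^ n → L`. -/
lemma tendsto_one_sub_mul_powerSum {u : ℕ → ℝ} {L : ℝ} (h : Tendsto u atTop (𝓝 L)) :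
    Tendsto (fun z => (1 - z) * powerSum u z) (𝓝[<] 1) (𝓝 L) := by
  -- The shift of `u`: partial sums of `u - w` telescope to `u n`, and multiplication by `1 - z`
  -- turns the series of `u` into that of `u - w`.
  let w : ℕ → ℝ := fun n => if n = 0 then 0 else u (n - 1)
  have hsum : ∀ n, ∑ i ∈ range (n + 1), (u i - w i) = u n := by
    intro n
    induction n with
    | zero => simp [w]
    | succ n ih => rw [sum_range_succ, ih]; simp [w]
  have hA := Real.tendsto_tsum_powerSeries_nhdsWithin_lt (f := fun n => u n - w n) (l := L)
    ((tendsto_add_atTop_iff_nat 1).1 (h.congr fun n => (hsum n).symm))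
  refine hA.congr' ?_
  have h0 : ∀ᶠ z : ℝ in 𝓝[<] 1, 0 < z :=
    mem_nhdsWithin_of_mem_nhds (lt_mem_nhds one_pos)
  filter_upwards [h0, self_mem_nhdsWithin] with z hz0 hz1
  have hz : |z| < 1 := by rw [abs_of_pos hz0]; exact hz1
  have h1 := (PolyBounded.of_tendsto h).hasSum hz
  have h2 := hasSum_mul_shift (v := w) h1 (by simp [w]) (fun n => by simp [w])
  have h3 := h1.sub h2
  rw [sub_mul, one_mul, ← h3.tsum_eq]
  exact tsum_congr fun n => by ring

/-! ### The hypergeometric series with `c = a + b` -/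

/-- The coefficients of `₂F₁ a b c`. -/
def hyperCoeff (a b c : ℝ) (n : ℕ) : ℝ := ordinaryHypergeometricCoefficient a b c n

lemma ordinaryHypergeometric_eq_powerSum (a b c z : ℝ) :
    ₂F₁ a b c z = powerSum (hyperCoeff a b c) z := by
  rw [ordinaryHypergeometric_eq_tsum]
  rfl

lemma hyperCoeff_succ {a b c : ℝ} (hc : ∀ n : ℕ, c + n ≠ 0) (n : ℕ) :
    ((n : ℝ) + 1) * (c + n) * hyperCoeff a b c (n + 1) = (a + n) * (b + n) * hyperCoeff a b c n := by
  have h1 : ((n : ℝ) + 1) ≠ 0 := by positivity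
  have h2 : ((n.factorial : ℕ) : ℝ) ≠ 0 := by positivity
  have h3 := hc n
  have h4 : (ascPochhammer ℝ n).eval c ≠ 0 := by
    rw [Ne, ascPochhammer_eval_eq_zero_iff]
    rintro ⟨k, -, hk⟩
    exact hc k (by rw [hk]; ring)
  simp only [hyperCoeff, ordinaryHypergeometricCoefficient, ascPochhammer_succ_eval,
    Nat.factorial_succ]
  push_cast
  field_simp

lemma ascPochhammer_eval_eq_prod (a : ℝ) (n : ℕ) :
    (ascPochhammer ℝ n).eval a = ∏ j ∈ range n, (a + j) := by
  induction n with
  | zero => simp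
  | succ n ih => rw [ascPochhammer_succ_eval, ih, prod_range_succ]

lemma ascPochhammer_eval_eq_GammaSeq (a : ℝ) {n : ℕ} (hn : n ≠ 0) :
    (ascPochhammer ℝ (n + 1)).eval a = (n : ℝ) ^ a * n.factorial * (Real.GammaSeq a n)⁻¹ := by
  have h : (n : ℝ) ^ a ≠ 0 := (Real.rpow_pos_of_pos (by positivity) a).ne'
  rw [ascPochhammer_eval_eq_prod, Real.GammaSeq, inv_div]
  field_simp

/-- Holds at the poles too: there `Real.Gamma` is `0` by convention, and `GammaSeq` is eventually a
division by zero. -/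
lemma tendsto_inv_GammaSeq (a : ℝ) :
    Tendsto (fun n => (Real.GammaSeq a n)⁻¹) atTop (𝓝 (Real.Gamma a)⁻¹) := by
  by_cases h : Real.Gamma a = 0
  · obtain ⟨m, hm⟩ := (Real.Gamma_eq_zero_iff a).1 h
    rw [h, inv_zero]
    refine tendsto_const_nhds.congr' ?_
    filter_upwards [eventually_ge_atTop m] with n hn
    rw [Real.GammaSeq, prod_eq_zero (i := m) (by simp; omega) (by rw [hm]; ring)]
    simp
  · exact (Real.GammaSeq_tendsto_Gamma a).inv₀ h

/-- Euler's limit applied to each Pochhammer symbol; `a + b = c` is exactly what cancels the powers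
of `n`. -/
lemma tendsto_derivCoeff_hyperCoeff {a b c : ℝ} (hab : a + b = c) :
    Tendsto (derivCoeff (hyperCoeff a b c)) atTop
      (𝓝 (Real.Gamma c * (Real.Gamma a)⁻¹ * (Real.Gamma b)⁻¹)) := by
  refine (((Real.GammaSeq_tendsto_Gamma c).mul (tendsto_inv_GammaSeq a)).mul
    (tendsto_inv_GammaSeq b)).congr' ?_
  filter_upwards [eventually_ne_atTop 0] with n hn
  have h2 : ((n.factorial : ℕ) : ℝ) ≠ 0 := by positivity
  have hpos : (0 : ℝ) < n := by positivity
  have ha : (n : ℝ) ^ a ≠ 0 := (Real.rpow_pos_of_pos hpos a).ne'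
  have hb : (n : ℝ) ^ b ≠ 0 := (Real.rpow_pos_of_pos hpos b).ne'
  simp only [derivCoeff, hyperCoeff, ordinaryHypergeometricCoefficient]
  rw [ascPochhammer_eval_eq_GammaSeq a hn, ascPochhammer_eval_eq_GammaSeq b hn,
    ascPochhammer_eval_eq_GammaSeq c hn, Nat.factorial_succ, ← hab, Real.rpow_add hpos]
  push_cast
  have h1 : ((n : ℝ) + 1) ≠ 0 := by positivity
  simp only [mul_inv, inv_inv]
  field_simp

lemma polyBounded_hyperCoeff {a b c : ℝ} (hab : a + b = c) : PolyBounded (hyperCoeff a b c) := by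
  obtain ⟨M, hM⟩ := (tendsto_derivCoeff_hyperCoeff hab).abs.bddAbove_range
  have hM' : ∀ n, |derivCoeff (hyperCoeff a b c) n| ≤ M := fun n => hM ⟨n, rfl⟩
  have hM0 : 0 ≤ M := (abs_nonneg _).trans (hM' 0)
  refine ⟨M + 1, 0, by positivity, fun n => ?_⟩
  rw [pow_zero, mul_one]
  cases n with
  | zero => simpa [hyperCoeff] using hM0
  | succ n =>
    have h := hM' n
    have hn : (0 : ℝ) ≤ n := n.cast_nonneg
    rw [derivCoeff, abs_mul, abs_of_nonneg (by positivity : (0 : ℝ) ≤ n + 1)] at h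
    nlinarith [abs_nonneg (hyperCoeff a b c (n + 1))]

lemma tendsto_hyperCoeff {a b c : ℝ} (hab : a + b = c) :
    Tendsto (hyperCoeff a b c) atTop (𝓝 0) := by
  rw [← tendsto_add_atTop_iff_nat 1]
  have h := (tendsto_derivCoeff_hyperCoeff hab).mul tendsto_one_div_add_atTop_nhds_zero_nat
  rw [mul_zero] at h
  refine h.congr fun n => ?_
  have h1 : ((n : ℝ) + 1) ≠ 0 := by positivity
  rw [derivCoeff]
  field_simp

/-- The derivative of `₂F₁ a b c`. -/
def hyperDeriv (a b c z : ℝ) : ℝ := powerSum (derivCoeff (hyperCoeff a b c)) z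

lemma hasDerivAt_hypergeometric {a b c z : ℝ} (hab : a + b = c) (hz : |z| < 1) :
    HasDerivAt (₂F₁ a b c) (hyperDeriv a b c z) z := by
  rw [show ₂F₁ a b c = powerSum (hyperCoeff a b c) from
    funext (ordinaryHypergeometric_eq_powerSum a b c)]
  exact hasDerivAt_powerSum (polyBounded_hyperCoeff hab) hz

/-- The hypergeometric differential equation, in self-adjoint form. -/
lemma hasDerivAt_hyperDeriv {a b c z : ℝ} (hab : a + b = c) (hc : ∀ n : ℕ, c + n ≠ 0)
    (hz : |z| < 1) :
    ∃ F'' : ℝ, HasDerivAt (hyperDeriv a b c) F'' z ∧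
      z * (1 - z) * F'' + (c - (c + 1) * z) * hyperDeriv a b c z = a * b * ₂F₁ a b c z := by
  have hp := polyBounded_hyperCoeff hab
  refine ⟨_, hasDerivAt_powerSum hp.derivCoeff hz, ?_⟩
  set u := hyperCoeff a b c with hu
  have h0 := hp.hasSum hz
  have h1 := hp.derivCoeff.hasSum hz
  have h2 := hp.derivCoeff.derivCoeff.hasSum hz
  have h1z := hasSum_mul_shift (v := fun n => n * u n) h1 (by simp)
    (fun n => by rw [derivCoeff]; push_cast; ring)
  have h2z := hasSum_mul_shift (v := fun n => n * ((n + 1) * u (n + 1))) h2 (by simp)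
    (fun n => by simp only [derivCoeff]; push_cast; ring)
  have h2zz := hasSum_mul_shift (v := fun n => n * ((n - 1) * u n)) h2z (by simp)
    (fun n => by push_cast; ring)
  have hs := ((h2z.sub h2zz).add ((h1.mul_left c).sub (h1z.mul_left (c + 1)))).sub
    (h0.mul_left (a * b))
  -- Coefficientwise, the differential equation is the two-term recurrence `hyperCoeff_succ`.
  rw [show (fun n : ℕ => _) = fun _ => (0 : ℝ) from funext fun n => ?_] at hs
  · have h := hs.unique hasSum_zero
    rw [ordinaryHypergeometric_eq_powerSum, hyperDeriv, ← hu]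
    linarith
  · have h := hyperCoeff_succ (a := a) (b := b) hc n
    rw [← hu] at h
    simp only [derivCoeff]
    rw [← hab] at h ⊢
    linear_combination (z ^ n) * h

/-- For `c = a + b` the singularity at `1` is at most logarithmic; this limit is its coefficient. -/
lemma tendsto_one_sub_mul_hyperDeriv {a b c : ℝ} (hab : a + b = c) :
    Tendsto (fun z => (1 - z) * hyperDeriv a b c z) (𝓝[<] 1)
      (𝓝 (Real.Gamma c * (Real.Gamma a)⁻¹ * (Real.Gamma b)⁻¹)) :=
  tendsto_one_sub_mul_powerSum (tendsto_derivCoeff_hyperCoeff hab)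

lemma tendsto_one_sub_mul_hypergeometric {a b c : ℝ} (hab : a + b = c) :
    Tendsto (fun z : ℝ => (1 - z) * ₂F₁ a b c z) (𝓝[<] 1) (𝓝 0) := by
  simp only [ordinaryHypergeometric_eq_powerSum]
  exact tendsto_one_sub_mul_powerSum (tendsto_hyperCoeff hab)

/-! ### The Legendre equation as a first-order system -/

/-- `f` solves the Legendre equation of degree `ν` on `(-1, 1)` with flux `g = (1 - x²) f'`. -/
structure IsLegendre (ν : ℝ) (f g : ℝ → ℝ) : Prop where
  sol : ∀ x ∈ Set.Ioo (-1 : ℝ) 1, HasDerivAt f (g x / (1 - x ^ 2)) x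
  flux : ∀ x ∈ Set.Ioo (-1 : ℝ) 1, HasDerivAt g (-(ν * (ν + 1)) * f x) x

lemma one_sub_sq_pos {x : ℝ} (hx : x ∈ Set.Ioo (-1 : ℝ) 1) : 0 < 1 - x ^ 2 := by
  nlinarith [hx.1, hx.2]

lemma zero_mem_Ioo : (0 : ℝ) ∈ Set.Ioo (-1 : ℝ) 1 := by constructor <;> norm_num

lemma IsLegendre.wronskian_eq {ν : ℝ} {f g p q : ℝ → ℝ} (h : IsLegendre ν f g)
    (k : IsLegendre ν p q) {x : ℝ} (hx : x ∈ Set.Ioo (-1 : ℝ) 1) :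
    f x * q x - p x * g x = f 0 * q 0 - p 0 * g 0 := by
  have hd : ∀ y ∈ Set.Ioo (-1 : ℝ) 1, HasDerivAt (fun y => f y * q y - p y * g y) 0 y := by
    intro y hy
    have h1 := ((h.sol y hy).mul (k.flux y hy)).sub ((k.sol y hy).mul (h.flux y hy))
    exact h1.congr_deriv (by ring)
  exact isOpen_Ioo.is_const_of_deriv_eq_zero isPreconnected_Ioo
    (fun y hy => (hd y hy).differentiableAt.differentiableWithinAt) (fun y hy => (hd y hy).deriv)
    hx zero_mem_Ioo

/-- The even solution of the Legendre equation with value `1` at the origin. -/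
def evenSol (ν x : ℝ) : ℝ := ₂F₁ (-ν / 2) ((ν + 1) / 2) (1 / 2 : ℝ) (x ^ 2)

/-- The flux of `evenSol`. -/
def evenFlux (ν x : ℝ) : ℝ :=
  2 * x * ((1 - x ^ 2) * hyperDeriv (-ν / 2) ((ν + 1) / 2) (1 / 2) (x ^ 2))

/-- The odd solution of the Legendre equation with slope `1` at the origin. -/
def oddSol (ν x : ℝ) : ℝ := x * ₂F₁ ((1 - ν) / 2) (ν / 2 + 1) (3 / 2 : ℝ) (x ^ 2)

/-- The flux of `oddSol`. -/
def oddFlux (ν x : ℝ) : ℝ :=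
  (1 - x ^ 2) * ₂F₁ ((1 - ν) / 2) (ν / 2 + 1) (3 / 2 : ℝ) (x ^ 2)
    + 2 * x ^ 2 * ((1 - x ^ 2) * hyperDeriv ((1 - ν) / 2) (ν / 2 + 1) (3 / 2) (x ^ 2))

/-- The flux of `legendreP`. -/
def legendrePFlux (ν x : ℝ) : ℝ :=
  -((1 - x ^ 2) / 2) * hyperDeriv (-ν) (1 + ν) 1 ((1 - x) / 2)

lemma even_add (ν : ℝ) : -ν / 2 + (ν + 1) / 2 = 1 / 2 := by ring

lemma odd_add (ν : ℝ) : (1 - ν) / 2 + (ν / 2 + 1) = 3 / 2 := by ring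

lemma legendreP_add (ν : ℝ) : -ν + (1 + ν) = 1 := by ring

lemma abs_sq_lt_one {x : ℝ} (hx : x ∈ Set.Ioo (-1 : ℝ) 1) : |x ^ 2| < 1 := by
  rw [abs_of_nonneg (sq_nonneg x)]
  linarith [one_sub_sq_pos hx]

lemma hasDerivAt_sq (x : ℝ) : HasDerivAt (fun x : ℝ => x ^ 2) (2 * x) x := by
  simpa using hasDerivAt_pow 2 x

lemma hasDerivAt_comp_sq {F : ℝ → ℝ} {F' x : ℝ} (h : HasDerivAt F F' (x ^ 2)) :
    HasDerivAt (fun x => F (x ^ 2)) (F' * (2 * x)) x :=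
  HasDerivAt.comp (h := fun x : ℝ => x ^ 2) x h (hasDerivAt_sq x)

lemma isLegendre_even (ν : ℝ) : IsLegendre ν (evenSol ν) (evenFlux ν) := by
  constructor
  · intro x hx
    have h := hasDerivAt_comp_sq (hasDerivAt_hypergeometric (even_add ν) (abs_sq_lt_one hx))
    have h0 := (one_sub_sq_pos hx).ne'
    refine h.congr_deriv ?_
    rw [evenFlux]
    field_simp
  · intro x hx
    obtain ⟨F'', h2, hode⟩ := hasDerivAt_hyperDeriv (even_add ν)
      (fun n => by positivity) (abs_sq_lt_one hx)
    have h := ((hasDerivAt_id x).const_mul 2).mul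
      (((hasDerivAt_sq x).const_sub 1).mul (hasDerivAt_comp_sq h2))
    refine h.congr_deriv ?_
    simp only [id, Pi.mul_apply]
    rw [evenSol]
    -- With `z = x²`, the factor `4` matches `4ab = -ν(ν + 1)`.
    linear_combination 4 * hode

lemma isLegendre_odd (ν : ℝ) : IsLegendre ν (oddSol ν) (oddFlux ν) := by
  constructor
  · intro x hx
    have h := (hasDerivAt_id x).mul
      (hasDerivAt_comp_sq (hasDerivAt_hypergeometric (odd_add ν) (abs_sq_lt_one hx)))
    have h0 := (one_sub_sq_pos hx).ne'
    refine h.congr_deriv ?_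
    simp only [id, oddFlux]
    field_simp
  · intro x hx
    obtain ⟨F'', h2, hode⟩ := hasDerivAt_hyperDeriv (odd_add ν)
      (fun n => by positivity) (abs_sq_lt_one hx)
    have h1 := hasDerivAt_comp_sq (hasDerivAt_hypergeometric (odd_add ν) (abs_sq_lt_one hx))
    have h := (((hasDerivAt_sq x).const_sub 1).mul h1).add
      (((hasDerivAt_sq x).const_mul 2).mul
        (((hasDerivAt_sq x).const_sub 1).mul (hasDerivAt_comp_sq h2)))
    refine h.congr_deriv ?_
    simp only [Pi.mul_apply]
    rw [oddSol]
    linear_combination 4 * x * hode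

lemma isLegendre_legendreP (ν : ℝ) : IsLegendre ν (legendreP ν) (legendrePFlux ν) := by
  have hz : ∀ x ∈ Set.Ioo (-1 : ℝ) 1, |(1 - x) / 2| < 1 := by
    intro x hx
    rw [abs_lt]
    constructor <;> linarith [hx.1, hx.2]
  have hd : ∀ x : ℝ, HasDerivAt (fun x : ℝ => (1 - x) / 2) (-1 / 2) x := fun x =>
    ((hasDerivAt_id x).const_sub 1).div_const 2
  constructor
  · intro x hx
    have h := (hasDerivAt_hypergeometric (legendreP_add ν) (hz x hx)).comp x (hd x)
    have h0 := (one_sub_sq_pos hx).ne'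
    refine h.congr_deriv ?_
    rw [legendrePFlux]
    field_simp
  · intro x hx
    obtain ⟨F'', h2, hode⟩ := hasDerivAt_hyperDeriv (legendreP_add ν)
      (fun n => by positivity) (hz x hx)
    have h := ((((hasDerivAt_sq x).const_sub 1).div_const 2).neg).mul (h2.comp x (hd x))
    refine h.congr_deriv ?_
    simp only [Function.comp_apply, Pi.neg_apply]
    rw [legendreP]
    linear_combination hode

@[simp] lemma evenSol_zero (ν : ℝ) : evenSol ν 0 = 1 := by simp [evenSol]
@[simp] lemma evenFlux_zero (ν : ℝ) : evenFlux ν 0 = 0 := by simp [evenFlux]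
@[simp] lemma oddSol_zero (ν : ℝ) : oddSol ν 0 = 0 := by simp [oddSol]
@[simp] lemma oddFlux_zero (ν : ℝ) : oddFlux ν 0 = 1 := by simp [oddFlux]
lemma evenSol_neg (ν x : ℝ) : evenSol ν (-x) = evenSol ν x := by simp [evenSol]
lemma oddSol_neg (ν x : ℝ) : oddSol ν (-x) = -oddSol ν x := by simp [oddSol]

lemma wronskian_even_odd (ν : ℝ) {x : ℝ} (hx : x ∈ Set.Ioo (-1 : ℝ) 1) :
    evenSol ν x * oddFlux ν x - oddSol ν x * evenFlux ν x = 1 := by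
  simpa using (isLegendre_even ν).wronskian_eq (isLegendre_odd ν) hx

/-- A solution is determined by its initial data at the origin. -/
lemma IsLegendre.eq_combination {ν : ℝ} {f g : ℝ → ℝ} (h : IsLegendre ν f g) {x : ℝ}
    (hx : x ∈ Set.Ioo (-1 : ℝ) 1) :
    f x = f 0 * evenSol ν x + g 0 * oddSol ν x ∧
      g x = f 0 * evenFlux ν x + g 0 * oddFlux ν x := by
  have h1 := h.wronskian_eq (isLegendre_odd ν) hx
  have h2 := (isLegendre_even ν).wronskian_eq h hx
  have h3 := wronskian_even_odd ν hx
  simp only [oddFlux_zero, oddSol_zero, evenFlux_zero, evenSol_zero] at h1 h2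
  constructor
  -- Cramer's rule: `h1` and `h2` express `f 0` and `g 0` through Wronskians, and the determinant
  -- `h3` is `1`.
  · linear_combination (-f x) * h3 + evenSol ν x * h1 + oddSol ν x * h2
  · linear_combination (-g x) * h3 + evenFlux ν x * h1 + oddFlux ν x * h2

/-! ### The values of `legendreP` and its derivative at the origin -/

lemma tendsto_sq_nhdsLT_one : Tendsto (fun x : ℝ => x ^ 2) (𝓝[<] 1) (𝓝[<] 1) := by
  refine tendsto_nhdsWithin_iff.2 ⟨?_, ?_⟩
  · have h : Tendsto (fun x : ℝ => x ^ 2) (𝓝 1) (𝓝 (1 ^ 2)) := (continuous_pow 2).tendsto 1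
    rw [one_pow] at h
    exact h.mono_left nhdsWithin_le_nhds
  · filter_upwards [Ioo_mem_nhdsLT (by norm_num : (-1 : ℝ) < 1)] with x hx
    exact sub_pos.1 (one_sub_sq_pos hx)

lemma tendsto_nhdsLT_of_continuousAt {f : ℝ → ℝ} {a y : ℝ} (h : ContinuousAt f a) (hy : f a = y) :
    Tendsto f (𝓝[<] a) (𝓝 y) := hy ▸ h.tendsto.mono_left nhdsWithin_le_nhds

lemma tendsto_evenFlux (ν : ℝ) :
    Tendsto (evenFlux ν) (𝓝[<] 1) (𝓝 (2 * (Real.Gamma (1 / 2) * (Real.Gamma (-ν / 2))⁻¹ *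
      (Real.Gamma ((ν + 1) / 2))⁻¹))) := by
  have h1 : Tendsto (fun x : ℝ => 2 * x) (𝓝[<] 1) (𝓝 2) :=
    tendsto_nhdsLT_of_continuousAt (by fun_prop) (by norm_num)
  exact h1.mul ((tendsto_one_sub_mul_hyperDeriv (even_add ν)).comp tendsto_sq_nhdsLT_one)

lemma tendsto_oddFlux (ν : ℝ) :
    Tendsto (oddFlux ν) (𝓝[<] 1) (𝓝 (2 * (Real.Gamma (3 / 2) * (Real.Gamma ((1 - ν) / 2))⁻¹ *
      (Real.Gamma (ν / 2 + 1))⁻¹))) := by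
  have h1 : Tendsto (fun x : ℝ => 2 * x ^ 2) (𝓝[<] 1) (𝓝 2) :=
    tendsto_nhdsLT_of_continuousAt (by fun_prop) (by norm_num)
  have h := ((tendsto_one_sub_mul_hypergeometric (odd_add ν)).comp tendsto_sq_nhdsLT_one).add
    (h1.mul ((tendsto_one_sub_mul_hyperDeriv (odd_add ν)).comp tendsto_sq_nhdsLT_one))
  rw [zero_add] at h
  exact h

lemma tendsto_evenSol_mul (ν : ℝ) :
    Tendsto (fun x => (1 - x ^ 2) * evenSol ν x) (𝓝[<] 1) (𝓝 0) :=
  (tendsto_one_sub_mul_hypergeometric (even_add ν)).comp tendsto_sq_nhdsLT_one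

lemma tendsto_oddSol_mul (ν : ℝ) :
    Tendsto (fun x => (1 - x ^ 2) * oddSol ν x) (𝓝[<] 1) (𝓝 0) := by
  have h1 : Tendsto (fun x : ℝ => x) (𝓝[<] 1) (𝓝 1) :=
    tendsto_nhdsLT_of_continuousAt (by fun_prop) rfl
  have h := h1.mul ((tendsto_one_sub_mul_hypergeometric (odd_add ν)).comp tendsto_sq_nhdsLT_one)
  rw [mul_zero] at h
  refine h.congr fun x => ?_
  simp only [Function.comp_apply, oddSol]
  ring

lemma tendsto_legendreP (ν : ℝ) : Tendsto (legendreP ν) (𝓝[<] 1) (𝓝 1) := by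
  refine tendsto_nhdsLT_of_continuousAt ?_ (by simp [legendreP])
  have h := (hasDerivAt_hypergeometric (z := (1 - 1) / 2) (legendreP_add ν) (by simp)).continuousAt
  exact ContinuousAt.comp (f := fun x : ℝ => (1 - x) / 2) h (by fun_prop)

/-- The flux of `P` is `1 - x²` times a factor bounded near `x = 1`, which beats the singularity of
`evenSol` and `oddSol`. -/
lemma tendsto_mul_legendrePFlux (ν : ℝ) {f : ℝ → ℝ}
    (hf : Tendsto (fun x => (1 - x ^ 2) * f x) (𝓝[<] 1) (𝓝 0)) :
    Tendsto (fun x => f x * legendrePFlux ν x) (𝓝[<] 1) (𝓝 0) := by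
  obtain ⟨F'', h2, -⟩ := hasDerivAt_hyperDeriv (z := (1 - 1) / 2) (legendreP_add ν)
    (fun n => by positivity) (by simp)
  have hc := tendsto_nhdsLT_of_continuousAt
    (ContinuousAt.comp (f := fun x : ℝ => (1 - x) / 2) h2.continuousAt (by fun_prop)) rfl
  have h := (hf.mul hc).const_mul (-(1 / 2))
  rw [zero_mul, mul_zero] at h
  refine h.congr fun x => ?_
  simp only [Function.comp_apply, legendrePFlux]
  ring

/-- The value of `legendreP ν` at the origin. -/
def legendrePValue (ν : ℝ) : ℝ :=
  √Real.pi * ((Real.Gamma ((1 - ν) / 2))⁻¹ * (Real.Gamma (ν / 2 + 1))⁻¹)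

/-- The slope of `legendreP ν` at the origin. -/
def legendrePSlope (ν : ℝ) : ℝ :=
  -(2 * √Real.pi) * ((Real.Gamma (-ν / 2))⁻¹ * (Real.Gamma ((ν + 1) / 2))⁻¹)

/-- The Wronskian with `oddSol` is `P(0)` at the origin; as `x → 1` only the limit of `oddFlux`
survives, because `P → 1`. -/
lemma legendreP_zero_right (ν : ℝ) : legendreP ν 0 = legendrePValue ν := by
  have h1 := ((tendsto_legendreP ν).mul (tendsto_oddFlux ν)).sub
    (tendsto_mul_legendrePFlux ν (tendsto_oddSol_mul ν))
  have h2 : Tendsto (fun x => legendreP ν x * oddFlux ν x - oddSol ν x * legendrePFlux ν x)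
      (𝓝[<] 1) (𝓝 (legendreP ν 0)) := by
    refine tendsto_const_nhds.congr' ?_
    filter_upwards [Ioo_mem_nhdsLT (by norm_num : (-1 : ℝ) < 1)] with x hx
    simpa using ((isLegendre_legendreP ν).wronskian_eq (isLegendre_odd ν) hx).symm
  rw [tendsto_nhds_unique h2 h1, legendrePValue,
    show (3 / 2 : ℝ) = 1 / 2 + 1 by norm_num, Real.Gamma_add_one (by norm_num),
    Real.Gamma_one_half_eq]
  ring

lemma legendrePFlux_zero_right (ν : ℝ) : legendrePFlux ν 0 = legendrePSlope ν := by
  have h1 := (tendsto_mul_legendrePFlux ν (tendsto_evenSol_mul ν)).sub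
    ((tendsto_legendreP ν).mul (tendsto_evenFlux ν))
  have h2 : Tendsto (fun x => evenSol ν x * legendrePFlux ν x - legendreP ν x * evenFlux ν x)
      (𝓝[<] 1) (𝓝 (legendrePFlux ν 0)) := by
    refine tendsto_const_nhds.congr' ?_
    filter_upwards [Ioo_mem_nhdsLT (by norm_num : (-1 : ℝ) < 1)] with x hx
    simpa using ((isLegendre_even ν).wronskian_eq (isLegendre_legendreP ν) hx).symm
  rw [tendsto_nhds_unique h2 h1, legendrePSlope, Real.Gamma_one_half_eq]
  ring

lemma legendreP_eq (ν : ℝ) {x : ℝ} (hx : x ∈ Set.Ioo (-1 : ℝ) 1) :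
    legendreP ν x = legendrePValue ν * evenSol ν x + legendrePSlope ν * oddSol ν x := by
  rw [((isLegendre_legendreP ν).eq_combination hx).1, legendreP_zero_right,
    legendrePFlux_zero_right]

/-- The value of `legendreQ ν` at the origin. -/
def legendreQValue (ν : ℝ) : ℝ :=
  -(√Real.pi / 2) * Real.sin (Real.pi * ν / 2)
      * (Real.Gamma ((ν + 1) / 2) / Real.Gamma (ν / 2 + 1))

/-- The slope of `legendreQ ν` at the origin. -/
def legendreQSlope (ν : ℝ) : ℝ :=
  √Real.pi * Real.cos (Real.pi * ν / 2)
      * (Real.Gamma (ν / 2 + 1) / Real.Gamma ((ν + 1) / 2))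

lemma legendreQ_eq (ν x : ℝ) :
    legendreQ ν x = legendreQValue ν * evenSol ν x + legendreQSlope ν * oddSol ν x := by
  simp only [legendreQ, legendreQValue, legendreQSlope, evenSol, oddSol]
  ring

/-- The reflection formula; in inverse form it needs no exclusion of poles. -/
lemma inv_Gamma_mul_cos (ν : ℝ) :
    (Real.Gamma ((1 - ν) / 2))⁻¹ * (Real.Gamma ((ν + 1) / 2))⁻¹ =
      Real.cos (Real.pi * ν / 2) / Real.pi := by
  have h := Real.Gamma_mul_Gamma_one_sub ((1 - ν) / 2)
  rw [show 1 - (1 - ν) / 2 = (ν + 1) / 2 by ring,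
    show Real.pi * ((1 - ν) / 2) = Real.pi / 2 - Real.pi * ν / 2 by ring,
    Real.sin_pi_div_two_sub] at h
  rw [← mul_inv, h, inv_div]

lemma inv_Gamma_mul_sin (ν : ℝ) :
    (Real.Gamma (-ν / 2))⁻¹ * (Real.Gamma (ν / 2 + 1))⁻¹ =
      -Real.sin (Real.pi * ν / 2) / Real.pi := by
  have h := Real.Gamma_mul_Gamma_one_sub (-ν / 2)
  rw [show 1 - -ν / 2 = ν / 2 + 1 by ring,
    show Real.pi * (-ν / 2) = -(Real.pi * ν / 2) by ring, Real.sin_neg] at h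
  rw [← mul_inv, h, inv_div]

/-- The odd negative integers are poles of the first factor, the even ones of the second. -/
lemma Gamma_ne_zero_of_degree {ν : ℝ} (hν : ∀ k : ℕ, ν ≠ -((k : ℝ) + 1)) :
    Real.Gamma ((ν + 1) / 2) ≠ 0 ∧ Real.Gamma (ν / 2 + 1) ≠ 0 := by
  constructor
  · rw [Ne, Real.Gamma_eq_zero_iff]
    rintro ⟨m, hm⟩
    exact hν (2 * m) (by push_cast; linarith)
  · rw [Ne, Real.Gamma_eq_zero_iff]
    rintro ⟨m, hm⟩
    exact hν (2 * m + 1) (by push_cast; linarith)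

/-- By reflection the two products are `cos²` and `-sin²` of `πν/2`. -/
lemma wronskian_legendreP_legendreQ {ν : ℝ} (hν : ∀ k : ℕ, ν ≠ -((k : ℝ) + 1)) :
    legendrePValue ν * legendreQSlope ν - legendrePSlope ν * legendreQValue ν = 1 := by
  obtain ⟨h1, h2⟩ := Gamma_ne_zero_of_degree hν
  have hc := inv_Gamma_mul_cos ν
  have hs := inv_Gamma_mul_sin ν
  have hpi := Real.pi_ne_zero
  have hsq := Real.mul_self_sqrt Real.pi_pos.le
  have e1 : legendrePValue ν * legendreQSlope ν = Real.cos (Real.pi * ν / 2) ^ 2 := by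
    calc _ = (√Real.pi * √Real.pi) * Real.cos (Real.pi * ν / 2) *
          ((Real.Gamma ((1 - ν) / 2))⁻¹ * (Real.Gamma ((ν + 1) / 2))⁻¹) *
          ((Real.Gamma (ν / 2 + 1))⁻¹ * Real.Gamma (ν / 2 + 1)) := by
            rw [legendrePValue, legendreQSlope]; ring
      _ = _ := by rw [hc, hsq, inv_mul_cancel₀ h2]; field_simp
  have e2 : legendrePSlope ν * legendreQValue ν = -Real.sin (Real.pi * ν / 2) ^ 2 := by
    calc _ = (√Real.pi * √Real.pi) * Real.sin (Real.pi * ν / 2) *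
          ((Real.Gamma (-ν / 2))⁻¹ * (Real.Gamma (ν / 2 + 1))⁻¹) *
          ((Real.Gamma ((ν + 1) / 2))⁻¹ * Real.Gamma ((ν + 1) / 2)) := by
            rw [legendrePSlope, legendreQValue]; ring
      _ = _ := by rw [hs, hsq, inv_mul_cancel₀ h1]; field_simp
  rw [e1, e2]
  linarith [Real.sin_sq_add_cos_sq (Real.pi * ν / 2)]

lemma legendrePValue_mul_slope (ν : ℝ) :
    legendrePValue ν * legendrePSlope ν = Real.sin (Real.pi * ν) / Real.pi := by
  have hpi := Real.pi_ne_zero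
  have hsq := Real.mul_self_sqrt Real.pi_pos.le
  calc _ = -2 * (√Real.pi * √Real.pi) *
        ((Real.Gamma ((1 - ν) / 2))⁻¹ * (Real.Gamma ((ν + 1) / 2))⁻¹) *
        ((Real.Gamma (-ν / 2))⁻¹ * (Real.Gamma (ν / 2 + 1))⁻¹) := by
          rw [legendrePValue, legendrePSlope]; ring
    _ = _ := by
      rw [inv_Gamma_mul_cos, inv_Gamma_mul_sin, hsq,
        show Real.pi * ν = 2 * (Real.pi * ν / 2) by ring, Real.sin_two_mul]
      field_simp

/-! ### The continuous determinant -/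

lemma neg_mem_Ioo {t : ℝ} (ht : t ∈ Set.Ioo (-1 : ℝ) 1) : -t ∈ Set.Ioo (-1 : ℝ) 1 :=
  ⟨by linarith [ht.2], by linarith [ht.1]⟩

lemma contDet_eq {l t : ℝ} (hl : ∀ k : ℕ, l ≠ -((k : ℝ) + 1)) (ht : t ∈ Set.Ioo (-1 : ℝ) 1) :
    contDet l t = 2 * evenSol l t * oddSol l t := by
  have h := wronskian_legendreP_legendreQ hl
  rw [contDet, legendreP_eq l ht, legendreP_eq l (neg_mem_Ioo ht), legendreQ_eq, legendreQ_eq,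
    evenSol_neg, oddSol_neg]
  linear_combination 2 * evenSol l t * oddSol l t * h

lemma contDet_eq_of_not_int {l t : ℝ} (hl : ∀ k : ℤ, l ≠ (k : ℝ)) (ht : t ∈ Set.Ioo (-1 : ℝ) 1) :
    contDet l t = Real.pi / (2 * Real.sin (Real.pi * l)) *
      (legendreP l t ^ 2 - legendreP l (-t) ^ 2) := by
  have hpi := Real.pi_ne_zero
  have hs : Real.sin (Real.pi * l) ≠ 0 := by
    rw [Ne, Real.sin_eq_zero_iff]
    rintro ⟨n, hn⟩
    refine hl n (mul_left_cancel₀ hpi ?_)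
    linarith
  have h := legendrePValue_mul_slope l
  rw [contDet_eq (fun k hk => hl (-((k : ℤ) + 1)) (by rw [hk]; push_cast; ring)) ht,
    legendreP_eq l ht, legendreP_eq l (neg_mem_Ioo ht), evenSol_neg, oddSol_neg]
  calc 2 * evenSol l t * oddSol l t = Real.pi / (2 * Real.sin (Real.pi * l)) *
        (4 * (Real.sin (Real.pi * l) / Real.pi) * evenSol l t * oddSol l t) := by
          field_simp; ring
    _ = _ := by rw [← h]; ring

lemma tanh_mem_Ioo (x : ℝ) : Real.tanh x ∈ Set.Ioo (-1 : ℝ) 1 :=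
  ⟨Real.neg_one_lt_tanh x, Real.tanh_lt_one x⟩

lemma one_sub_tanh_sq (x : ℝ) : 1 - Real.tanh x ^ 2 = 1 / Real.cosh x ^ 2 := by
  have h := (Real.cosh_pos x).ne'
  have h2 := Real.cosh_sq_sub_sinh_sq x
  rw [Real.tanh_eq_sinh_div_cosh]
  field_simp
  linarith

lemma hasDerivAt_tanh (x : ℝ) : HasDerivAt Real.tanh (1 - Real.tanh x ^ 2) x := by
  have h := (Real.hasDerivAt_sinh x).div (Real.hasDerivAt_cosh x) (Real.cosh_pos x).ne'
  rw [show Real.tanh = fun x => Real.sinh x / Real.cosh x from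
    funext Real.tanh_eq_sinh_div_cosh]
  refine h.congr_deriv ?_
  have h0 := (Real.cosh_pos x).ne'
  field_simp

lemma IsLegendre.combination {ν : ℝ} {f g p q : ℝ → ℝ} (h : IsLegendre ν f g)
    (k : IsLegendre ν p q) (a b : ℝ) :
    IsLegendre ν (fun x => a * f x + b * p x) (fun x => a * g x + b * q x) := by
  constructor
  · intro x hx
    refine (((h.sol x hx).const_mul a).add ((k.sol x hx).const_mul b)).congr_deriv ?_
    ring
  · intro x hx
    refine (((h.flux x hx).const_mul a).add ((k.flux x hx).const_mul b)).congr_deriv ?_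
    ring

/-- Legendre functions of `tanh x` solve the Schrödinger equation with Rosen–Morse potential. -/
lemma IsLegendre.comp_tanh {l : ℝ} {f g : ℝ → ℝ} (h : IsLegendre l f g) (x : ℝ) :
    HasDerivAt (fun x => f (Real.tanh x)) (g (Real.tanh x)) x ∧
      HasDerivAt (fun x => g (Real.tanh x)) (potential l x * f (Real.tanh x)) x := by
  have h0 := (one_sub_sq_pos (tanh_mem_Ioo x)).ne'
  constructor
  · refine ((h.sol _ (tanh_mem_Ioo x)).comp x (hasDerivAt_tanh x)).congr_deriv ?_
    field_simp
  · refine ((h.flux _ (tanh_mem_Ioo x)).comp x (hasDerivAt_tanh x)).congr_deriv ?_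
    rw [one_sub_tanh_sq, potential]
    ring

lemma isDetRatio_contDet {l : ℝ} (hl : ∀ k : ℕ, l ≠ -((k : ℝ) + 1)) :
    IsDetRatio (potential l) (-1 / 2) (1 / 2) (contDet l (Real.tanh (1 / 2))) := by
  set t := Real.tanh (1 / 2) with ht
  have ht' : t ∈ Set.Ioo (-1 : ℝ) 1 := tanh_mem_Ioo _
  have htn : Real.tanh (-1 / 2) = -t := by rw [ht, ← Real.tanh_neg]; norm_num
  have hw := wronskian_even_odd l ht'
  -- These coefficients make the solution vanish at `-t`; its flux there is the Wronskian of `E` and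
  -- `O`, namely `1`.
  have hsol := ((isLegendre_even l).combination (isLegendre_odd l)
    (oddSol l t) (evenSol l t))
  refine ⟨_, fun x => x + 1 / 2, ⟨_, fun x _ => (hsol.comp_tanh x).1.hasDerivWithinAt,
    fun x _ => (hsol.comp_tanh x).2.hasDerivWithinAt, ?_, ?_⟩,
    ⟨fun _ => 1, fun x _ => ?_, fun x _ => ?_, ?_, rfl⟩, ?_, ?_⟩
  · simp only [htn, evenSol_neg, oddSol_neg]
    ring
  · simp only [htn, evenFlux, oddFlux] at hw ⊢
    simp only [neg_sq]
    linear_combination hw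
  · exact ((hasDerivAt_id x).add_const _).hasDerivWithinAt
  · simpa using hasDerivWithinAt_const x _ (1 : ℝ)
  · norm_num
  · norm_num
  · rw [contDet_eq hl ht']
    simp only [← ht]
    norm_num
    ring

/-! ### Raising the degree by one -/

/-- The classical ladder `P_{ν+1} = x P_ν - (1 - x²) P_ν' / (ν + 1)`, valid for every solution. -/
lemma IsLegendre.raise {ν : ℝ} {f g : ℝ → ℝ} (h : IsLegendre ν f g) (hν : ν + 1 ≠ 0) :
    IsLegendre (ν + 1) (fun x => x * f x - g x / (ν + 1))
      (fun x => (1 - x ^ 2) * ((ν + 1) * f x) + x * g x) := by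
  constructor
  · intro x hx
    have h0 := (one_sub_sq_pos hx).ne'
    refine (((hasDerivAt_id x).mul (h.sol x hx)).sub
      ((h.flux x hx).div_const (ν + 1))).congr_deriv ?_
    simp only [id]
    field_simp
    ring
  · intro x hx
    have h0 := (one_sub_sq_pos hx).ne'
    refine ((((hasDerivAt_sq x).const_sub 1).mul ((h.sol x hx).const_mul (ν + 1))).add
      ((hasDerivAt_id x).mul (h.flux x hx))).congr_deriv ?_
    simp only [id]
    field_simp
    ring

/-- The solution of degree `ν` with value `p` and slope `q` at the origin. -/
def legendreSol (ν p q x : ℝ) : ℝ := p * evenSol ν x + q * oddSol ν x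

/-- The flux of `legendreSol`. -/
def legendreFlux (ν p q x : ℝ) : ℝ := p * evenFlux ν x + q * oddFlux ν x

lemma legendreSol_raise {ν : ℝ} (hν : ν + 1 ≠ 0) (p q : ℝ) {x : ℝ}
    (hx : x ∈ Set.Ioo (-1 : ℝ) 1) :
    legendreSol (ν + 1) (-q / (ν + 1)) ((ν + 1) * p) x =
        x * legendreSol ν p q x - legendreFlux ν p q x / (ν + 1) ∧
      legendreFlux (ν + 1) (-q / (ν + 1)) ((ν + 1) * p) x =
        (1 - x ^ 2) * ((ν + 1) * legendreSol ν p q x) + x * legendreFlux ν p q x := by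
  have h := (((isLegendre_even ν).combination (isLegendre_odd ν) p q).raise hν).eq_combination hx
  simp only [evenSol_zero, oddSol_zero, evenFlux_zero, oddFlux_zero] at h
  simp only [legendreSol, legendreFlux]
  rw [h.1, h.2]
  constructor <;> ring

/-- Initial data at the origin of a sequence of Legendre functions of degrees `0, 1, 2, …`, each
obtained from the previous one by raising the degree. -/
def IsLegendreData (p q : ℕ → ℝ) : Prop :=
  ∀ n : ℕ, p (n + 1) = -q n / ((n : ℝ) + 1) ∧ q (n + 1) = ((n : ℝ) + 1) * p n

lemma IsLegendreData.succ {p q : ℕ → ℝ} (h : IsLegendreData p q) (n : ℕ) {x : ℝ}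
    (hx : x ∈ Set.Ioo (-1 : ℝ) 1) :
    legendreSol (n + 1 : ℕ) (p (n + 1)) (q (n + 1)) x =
        x * legendreSol n (p n) (q n) x - legendreFlux n (p n) (q n) x / ((n : ℝ) + 1) ∧
      legendreFlux (n + 1 : ℕ) (p (n + 1)) (q (n + 1)) x =
        (1 - x ^ 2) * (((n : ℝ) + 1) * legendreSol n (p n) (q n) x) +
          x * legendreFlux n (p n) (q n) x := by
  rw [(h n).1, (h n).2]
  push_cast
  exact legendreSol_raise (by positivity) _ _ hx

/-- Bonnet's recurrence: eliminate the flux between two consecutive raisings. -/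
lemma IsLegendreData.recurrence {p q : ℕ → ℝ} (h : IsLegendreData p q) (n : ℕ) {x : ℝ}
    (hx : x ∈ Set.Ioo (-1 : ℝ) 1) :
    ((n : ℝ) + 2) * legendreSol (n + 2 : ℕ) (p (n + 2)) (q (n + 2)) x =
      (2 * (n : ℝ) + 3) * x * legendreSol (n + 1 : ℕ) (p (n + 1)) (q (n + 1)) x -
        ((n : ℝ) + 1) * legendreSol n (p n) (q n) x := by
  have h1 := h.succ n hx
  have h2 := (h.succ (n + 1) hx).1
  have hn : (n : ℝ) + 1 ≠ 0 := by positivity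
  have hn' : (n : ℝ) + 1 + 1 ≠ 0 := by positivity
  rw [h2, h1.2, h1.1]
  push_cast
  field_simp
  ring

/-- Raising swaps value and slope, so they vanish alternately; each equation with sign `-1` encodes
a vanishing. The sign `s` is `1` for `P` and `-1` for `Q`. -/
lemma IsLegendreData.parity {p q : ℕ → ℝ} (h : IsLegendreData p q) {s : ℝ}
    (hp : p 0 = s * p 0) (hq : q 0 = -s * q 0) (n : ℕ) :
    p n = s * (-1) ^ n * p n ∧ q n = -s * (-1) ^ n * q n := by
  induction n with
  | zero => rw [pow_zero, mul_one, mul_one]; exact ⟨hp, hq⟩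
  | succ n ih =>
    rw [(h n).1, (h n).2, pow_succ]
    constructor
    · linear_combination (-1 / ((n : ℝ) + 1)) * ih.2
    · linear_combination ((n : ℝ) + 1) * ih.1

/-- By `Γ(s + 1) = s Γ(s)`, raising `P_n` gives `P_{n+1}` exactly, without a constant. -/
lemma isLegendreData_legendreP :
    IsLegendreData (fun n => legendrePValue n) (fun n => legendrePSlope n) := by
  intro n
  have hn : (n : ℝ) + 1 ≠ 0 := by positivity
  have h1 : Real.Gamma (((n : ℝ) + 1) / 2 + 1) = ((n : ℝ) + 1) / 2 * Real.Gamma (((n : ℝ) + 1) / 2) :=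
    Real.Gamma_add_one (by positivity)
  have h2 : Real.Gamma ((1 - (n : ℝ)) / 2) =
      -(((n : ℝ) + 1) / 2) * Real.Gamma (-((n : ℝ) + 1) / 2) := by
    rw [show (1 - (n : ℝ)) / 2 = -((n : ℝ) + 1) / 2 + 1 by ring,
      Real.Gamma_add_one (div_ne_zero (neg_ne_zero.2 hn) two_ne_zero)]
    ring
  simp only [legendrePValue, legendrePSlope]
  push_cast
  rw [h1, h2, show (1 - ((n : ℝ) + 1)) / 2 = -(n : ℝ) / 2 by ring,
    show ((n : ℝ) + 1 + 1) / 2 = (n : ℝ) / 2 + 1 by ring]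
  simp only [mul_inv]
  constructor <;> field_simp

lemma isLegendreData_legendreQ :
    IsLegendreData (fun n => legendreQValue n) (fun n => legendreQSlope n) := by
  intro n
  have hn : (n : ℝ) + 1 ≠ 0 := by positivity
  have h1 : Real.Gamma (((n : ℝ) + 1) / 2 + 1) = ((n : ℝ) + 1) / 2 * Real.Gamma (((n : ℝ) + 1) / 2) :=
    Real.Gamma_add_one (by positivity)
  simp only [legendreQValue, legendreQSlope]
  push_cast
  rw [h1, show ((n : ℝ) + 1 + 1) / 2 = (n : ℝ) / 2 + 1 by ring,
    show Real.pi * ((n : ℝ) + 1) / 2 = Real.pi * n / 2 + Real.pi / 2 by ring,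
    Real.sin_add_pi_div_two, Real.cos_add_pi_div_two]
  constructor <;> field_simp

lemma legendreP_natCast (n : ℕ) {x : ℝ} (hx : x ∈ Set.Ioo (-1 : ℝ) 1) :
    legendreP n x = legendreSol n (legendrePValue n) (legendrePSlope n) x := legendreP_eq n hx

lemma legendreQ_natCast (n : ℕ) (x : ℝ) :
    legendreQ n x = legendreSol n (legendreQValue n) (legendreQSlope n) x := legendreQ_eq n x

/-! ### Degree zero -/

lemma legendrePValue_zero : legendrePValue 0 = 1 := by
  have h : √Real.pi ≠ 0 := (Real.sqrt_pos.2 Real.pi_pos).ne'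
  rw [legendrePValue, sub_zero, Real.Gamma_one_half_eq, zero_div, zero_add, Real.Gamma_one]
  field_simp

lemma legendrePSlope_zero : legendrePSlope 0 = 0 := by
  -- The convention `Γ(0) = 0` gives the correct value `1/Γ(0) = 0`.
  simp [legendrePSlope, Real.Gamma_zero]

lemma legendreQValue_zero : legendreQValue 0 = 0 := by simp [legendreQValue]

lemma legendreQSlope_zero : legendreQSlope 0 = 1 := by
  have h : √Real.pi ≠ 0 := (Real.sqrt_pos.2 Real.pi_pos).ne'
  rw [legendreQSlope, zero_add, Real.Gamma_one_half_eq, zero_div, zero_add, Real.Gamma_one]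
  simp [h]

lemma even_degree_zero {x : ℝ} (hx : x ∈ Set.Ioo (-1 : ℝ) 1) :
    evenSol 0 x = 1 ∧ evenFlux 0 x = 0 := by
  have h : IsLegendre 0 (fun _ => 1) (fun _ => 0) :=
    ⟨fun x _ => by simpa using hasDerivAt_const x (1 : ℝ),
      fun x _ => by simpa using hasDerivAt_const x (0 : ℝ)⟩
  have h1 := h.eq_combination hx
  simp only [one_mul, zero_mul, add_zero] at h1
  exact ⟨h1.1.symm, h1.2.symm⟩

lemma oddFlux_degree_zero {x : ℝ} (hx : x ∈ Set.Ioo (-1 : ℝ) 1) : oddFlux 0 x = 1 := by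
  have h := wronskian_even_odd 0 hx
  simpa [even_degree_zero hx] using h

/-- Identifies `oddSol 0` with `artanh`: along `tanh` its derivative is its flux, which is `1`. -/
lemma oddSol_degree_zero_tanh (x : ℝ) : oddSol 0 (Real.tanh x) = x := by
  have hd : ∀ y, HasDerivAt (fun y => oddSol 0 (Real.tanh y) - y) 0 y := fun y => by
    refine (((isLegendre_odd 0).comp_tanh y).1.sub (hasDerivAt_id y)).congr_deriv ?_
    rw [oddFlux_degree_zero (tanh_mem_Ioo y), sub_self]
  have h := is_const_of_deriv_eq_zero (fun y => (hd y).differentiableAt) (fun y => (hd y).deriv) x 0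
  simp only [Real.tanh_zero, oddSol_zero, sub_zero] at h
  linarith

/-! ### Christoffel's formula -/

section Christoffel

open PowerSeries

variable {x : ℝ} {P : ℕ → ℝ}

/-- The generating series of `P`. -/
def genSeries (P : ℕ → ℝ) : ℝ⟦X⟧ := PowerSeries.mk P

/-- The formal antiderivative of the generating series of `P`. -/
def genIntegral (P : ℕ → ℝ) : ℝ⟦X⟧ := PowerSeries.mk fun n => P (n - 1) / n

/-- The sum `∑ P (m - 1) P (l - m) / m` over `1 ≤ m ≤ l`. -/
def christoffelSum (P : ℕ → ℝ) (l : ℕ) : ℝ :=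
  ∑ m ∈ Icc 1 l, 1 / (m : ℝ) * (P (m - 1) * P (l - m))

lemma coeff_genIntegral_mul (P : ℕ → ℝ) (l : ℕ) :
    coeff l (genIntegral P * genSeries P) = christoffelSum P l := by
  rw [coeff_mul, Nat.sum_antidiagonal_eq_sum_range_succ_mk, christoffelSum]
  refine (sum_subset_zero_on_sdiff (fun m hm => ?_) (fun m hm => ?_) fun m _ => ?_).symm
  · rw [mem_Icc] at hm
    exact mem_range.2 (by omega)
  · rw [Finset.mem_sdiff, mem_Icc, mem_range] at hm
    have : m = 0 := by omega
    -- The constant term of `genIntegral` is `P 0 / 0 = 0`.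
    simp [this, genIntegral]
  · simp only [genIntegral, genSeries, coeff_mk]
    ring

lemma coeff_mul_derivative (x : ℝ) (f : ℝ⟦X⟧) :
    coeff 0 ((1 - C (2 * x) * X + X * X) * d⁄dX ℝ f) = coeff 1 f ∧
    ∀ n, coeff (n + 1) ((1 - C (2 * x) * X + X * X) * d⁄dX ℝ f) =
      (n + 2) * coeff (n + 2) f - 2 * x * ((n + 1) * coeff (n + 1) f) + n * coeff n f := by
  have e : (1 - C (2 * x) * X + X * X) * d⁄dX ℝ f =
      d⁄dX ℝ f - C (2 * x) * (X * d⁄dX ℝ f) + X * (X * d⁄dX ℝ f) := by ring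
  rw [e]
  constructor
  · simp only [map_sub, map_add, coeff_C_mul, coeff_zero_X_mul, coeff_derivative]
    simp
  · intro n
    cases n with
    | zero =>
      simp only [map_sub, map_add, coeff_C_mul, coeff_succ_X_mul, coeff_zero_X_mul,
        coeff_derivative]
      push_cast
      ring
    | succ n =>
      simp only [map_sub, map_add, coeff_C_mul, coeff_succ_X_mul, coeff_derivative]
      push_cast
      ring

lemma coeff_sub_mul (x : ℝ) (f : ℝ⟦X⟧) :
    coeff 0 ((C x - X) * f) = x * coeff 0 f ∧
    ∀ n, coeff (n + 1) ((C x - X) * f) = x * coeff (n + 1) f - coeff n f := by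
  constructor
  · simp [sub_mul]
  · intro n
    rw [sub_mul, map_sub, coeff_C_mul, coeff_succ_X_mul]

/-- The sequence `P` satisfies the three-term recurrence of the Legendre functions. -/
def IsLegendreRec (x : ℝ) (P : ℕ → ℝ) : Prop :=
  ∀ n : ℕ, ((n : ℝ) + 2) * P (n + 2) = (2 * (n : ℝ) + 3) * x * P (n + 1) - ((n : ℝ) + 1) * P n

/-- Bonnet's recurrence read as a differential equation; the initial values settle the constant
coefficient. -/
lemma genSeries_deriv (h0 : P 0 = 1) (h1 : P 1 = x) (h : IsLegendreRec x P) :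
    (1 - C (2 * x) * X + X * X) * d⁄dX ℝ (genSeries P) = (C x - X) * genSeries P := by
  ext n
  cases n with
  | zero =>
    rw [(coeff_mul_derivative x _).1, (coeff_sub_mul x _).1]
    simp [genSeries, h0, h1]
  | succ n =>
    rw [(coeff_mul_derivative x _).2, (coeff_sub_mul x _).2]
    simp only [genSeries, coeff_mk]
    linear_combination h n

lemma genIntegral_deriv (P : ℕ → ℝ) : d⁄dX ℝ (genIntegral P) = genSeries P := by
  ext n
  have hn : (n : ℝ) + 1 ≠ 0 := by positivity
  simp only [coeff_derivative, genIntegral, genSeries, coeff_mk, Nat.add_sub_cancel]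
  push_cast
  field_simp

/-- The left side has derivative `0` and constant term `1`: formally, the series is `(1 - 2xX +
X²)^(-1/2)`. -/
lemma genSeries_sq (h0 : P 0 = 1) (h1 : P 1 = x) (h : IsLegendreRec x P) :
    (1 - C (2 * x) * X + X * X) * genSeries P ^ 2 = 1 := by
  refine derivative.ext ?_ ?_
  · have hd := genSeries_deriv h0 h1 h
    simp only [Derivation.leibniz, map_add, map_sub, smul_eq_mul, derivative_X, derivative_C,
      pow_two, Derivation.map_one_eq_zero]
    have hC : (C (2 * x) : ℝ⟦X⟧) = 2 * C x := by rw [map_mul]; rfl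
    rw [hC] at hd ⊢
    linear_combination 2 * genSeries P * hd
  · simp [genSeries, h0]

lemma christoffel_deriv (h0 : P 0 = 1) (h1 : P 1 = x) (h : IsLegendreRec x P) :
    (1 - C (2 * x) * X + X * X) * d⁄dX ℝ (genIntegral P * genSeries P) =
      (C x - X) * (genIntegral P * genSeries P) + 1 := by
  rw [Derivation.leibniz, genIntegral_deriv, smul_eq_mul, smul_eq_mul]
  linear_combination genIntegral P * genSeries_deriv h0 h1 h + genSeries_sq h0 h1 h

/-- The inhomogeneity `1` in `christoffel_deriv` affects only the constant coefficient, so all later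
ones obey the homogeneous recurrence. -/
lemma christoffelSum_rec (h0 : P 0 = 1) (h1 : P 1 = x) (h : IsLegendreRec x P) :
    IsLegendreRec x (christoffelSum P) := by
  intro n
  have hc := congrArg (coeff (n + 1)) (christoffel_deriv h0 h1 h)
  rw [map_add, (coeff_mul_derivative x _).2, (coeff_sub_mul x _).2] at hc
  simp only [coeff_genIntegral_mul, coeff_one, Nat.succ_ne_zero, if_false] at hc
  linear_combination hc

end Christoffel

/-- Two sequences with the same recurrence and the same first two terms agree. -/
lemma IsLegendreRec.unique {x : ℝ} {P R : ℕ → ℝ} (hP : IsLegendreRec x P) (hR : IsLegendreRec x R)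
    (h0 : P 0 = R 0) (h1 : P 1 = R 1) (n : ℕ) : P n = R n := by
  induction n using Nat.twoStepInduction with
  | zero => exact h0
  | one => exact h1
  | more n ih1 ih2 =>
    have h2 : (n : ℝ) + 2 ≠ 0 := by positivity
    refine mul_left_cancel₀ h2 ?_
    rw [hP n, hR n, ih1, ih2]

/-! ### Integer degree: Christoffel's formula, parity and the determinant -/

section Integer

variable {x : ℝ}

lemma legendreP_rec (hx : x ∈ Set.Ioo (-1 : ℝ) 1) : IsLegendreRec x fun n => legendreP n x := by
  intro n
  simp only [legendreP_natCast _ hx]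
  exact isLegendreData_legendreP.recurrence n hx

lemma legendreQ_rec (hx : x ∈ Set.Ioo (-1 : ℝ) 1) : IsLegendreRec x fun n => legendreQ n x := by
  intro n
  simp only [legendreQ_natCast]
  exact isLegendreData_legendreQ.recurrence n hx

lemma legendreP_degree_zero (hx : x ∈ Set.Ioo (-1 : ℝ) 1) : legendreP (0 : ℕ) x = 1 := by
  rw [legendreP_natCast _ hx, legendreSol]
  simp [legendrePValue_zero, legendrePSlope_zero, even_degree_zero hx]

lemma legendreP_degree_one (hx : x ∈ Set.Ioo (-1 : ℝ) 1) : legendreP (1 : ℕ) x = x := by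
  rw [legendreP_natCast _ hx, ← zero_add 1, (isLegendreData_legendreP.succ 0 hx).1,
    ← legendreP_natCast _ hx, legendreP_degree_zero hx, legendreFlux]
  simp [legendrePSlope_zero, even_degree_zero hx]

lemma legendreQ_degree_zero (x : ℝ) : legendreQ (0 : ℕ) x = oddSol 0 x := by
  rw [legendreQ_natCast, legendreSol]
  simp [legendreQValue_zero, legendreQSlope_zero]

lemma legendreQ_degree_one (hx : x ∈ Set.Ioo (-1 : ℝ) 1) :
    legendreQ (1 : ℕ) x = x * oddSol 0 x - 1 := by
  rw [legendreQ_natCast, ← zero_add 1, (isLegendreData_legendreQ.succ 0 hx).1,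
    ← legendreQ_natCast, legendreQ_degree_zero x, legendreFlux]
  simp [legendreQValue_zero, legendreQSlope_zero, oddFlux_degree_zero hx]

/-- Christoffel's formula for the Legendre functions of the second kind of integer degree. -/
lemma legendreQ_eq_christoffel (hx : x ∈ Set.Ioo (-1 : ℝ) 1) (n : ℕ) :
    legendreQ n x = oddSol 0 x * legendreP n x - christoffelSum (fun n => legendreP n x) n := by
  have hP := legendreP_rec hx
  have hS := christoffelSum_rec (legendreP_degree_zero hx) (legendreP_degree_one hx) hP
  refine (legendreQ_rec hx).unique
    (R := fun n => oddSol 0 x * legendreP n x - christoffelSum (fun n => legendreP n x) n)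
    (fun n => ?_) ?_ ?_ n
  · linear_combination oddSol 0 x * hP n - hS n
  · simp only [legendreQ_degree_zero x, legendreP_degree_zero hx, christoffelSum]
    simp
  · simp only [legendreQ_degree_one hx, legendreP_degree_one hx, christoffelSum]
    simp only [Icc_self, sum_singleton, Nat.sub_self, legendreP_degree_zero hx, Nat.cast_one]
    ring

lemma legendreP_neg (hx : x ∈ Set.Ioo (-1 : ℝ) 1) (n : ℕ) :
    legendreP n (-x) = (-1) ^ n * legendreP n x := by
  obtain ⟨h1, h2⟩ := isLegendreData_legendreP.parity (s := 1) (by simp)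
    (by simp [legendrePSlope_zero]) n
  have hs : ((-1 : ℝ) ^ n) * (-1) ^ n = 1 := by rw [← mul_pow]; norm_num
  rw [legendreP_natCast n hx, legendreP_natCast n (neg_mem_Ioo hx), legendreSol, legendreSol,
    evenSol_neg, oddSol_neg]
  linear_combination evenSol n x * h1 - oddSol n x * h2

lemma legendreQ_neg (n : ℕ) : legendreQ n (-x) = -((-1) ^ n * legendreQ n x) := by
  obtain ⟨h1, h2⟩ := isLegendreData_legendreQ.parity (s := -1) (by simp [legendreQValue_zero])
    (by simp) n
  rw [legendreQ_natCast, legendreQ_natCast, legendreSol, legendreSol, evenSol_neg, oddSol_neg]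
  linear_combination evenSol n x * h1 - oddSol n x * h2

/-- By parity both terms of `contDet` equal `(-1)^l P_l Q_l`; Christoffel's formula with `artanh x =
1/2` then replaces `Q_l`. -/
lemma contDet_natCast (hx : x ∈ Set.Ioo (-1 : ℝ) 1) (hx' : oddSol 0 x = 1 / 2) (l : ℕ) :
    contDet l x = (-1) ^ l * legendreP l x * (legendreP l x -
      2 * ∑ m ∈ Icc 1 l, 1 / (m : ℝ) * (legendreP ((m : ℝ) - 1) x * legendreP ((l : ℝ) - m) x)) := by
  have hS : christoffelSum (fun n => legendreP n x) l =
      ∑ m ∈ Icc 1 l, 1 / (m : ℝ) * (legendreP ((m : ℝ) - 1) x * legendreP ((l : ℝ) - m) x) := by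
    refine sum_congr rfl fun m hm => ?_
    obtain ⟨h1, h2⟩ := mem_Icc.1 hm
    simp only [Nat.cast_sub h1, Nat.cast_sub h2, Nat.cast_one]
  rw [← hS, contDet, legendreP_neg hx, legendreQ_neg, legendreQ_eq_christoffel hx, hx']
  ring

end Integer

end RosenMorse

end

theorem mainTheorem5 (t : ℝ) (ht : t = Real.tanh (1 / 2)) :
    (∀ l : ℝ, (∀ k : ℕ, l ≠ -((k : ℝ) + 1)) →
      RosenMorse.IsDetRatio (RosenMorse.potential l) (-1 / 2) (1 / 2) (RosenMorse.contDet l t)) ∧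
    (∀ l : ℝ, (∀ k : ℤ, l ≠ (k : ℝ)) →
      RosenMorse.contDet l t = Real.pi / (2 * Real.sin (Real.pi * l)) *
        (RosenMorse.legendreP l t ^ 2 - RosenMorse.legendreP l (-t) ^ 2)) ∧
    (∀ l : ℕ,
      RosenMorse.contDet (l : ℝ) t = (-1) ^ l * RosenMorse.legendreP (l : ℝ) t *
        (RosenMorse.legendreP (l : ℝ) t -
          2 * ∑ m ∈ Finset.Icc 1 l, 1 / (m : ℝ) *
            (RosenMorse.legendreP ((m : ℝ) - 1) t *
              RosenMorse.legendreP ((l : ℝ) - (m : ℝ)) t))) := by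
  subst ht
  exact ⟨fun l hl => RosenMorse.isDetRatio_contDet hl,
    fun l hl => RosenMorse.contDet_eq_of_not_int hl (RosenMorse.tanh_mem_Ioo _),
    fun l => RosenMorse.contDet_natCast (RosenMorse.tanh_mem_Ioo _)
      (RosenMorse.oddSol_degree_zero_tanh _) l⟩
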